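/- Let $X$ be a topological manifold without boundary of dimension $n$ (Hausdorff, second countable), and let $\Phi : X\times\mathbb{R}\to X$ be a continuous flow. Let $S\subset X$ be a global Poincaré section of $\Phi$, that is: (a) $S$ is a closed subset of $X$ and a locally flat submanifold of codimension one without boundary: each $x\in S$ has a neighborhood $U$ in $X$ with a homeomorphism $\phi$ of $U$ onto the open unit ball $B\subset\mathbb{R}^n$ such that $\phi(U\cap S)=B\cap(\mathbb{R}^{n-1}\times\{0\})$; (b) there are functions $\delta_+>0$ and $\delta_-<0$ on $S$ such that, for each $x\in S$, a neighborhood $U$ as in (a) can be chosen so that $\Phi(x,[\delta_-(x),0))$ and $\Phi(x,(0,\delta_+(x)])$ are contained in different connected components of $U\setminus S$, and $\Phi(x,[\delta_-(x),\delta_+(x)])\cap S=\{x\}$; moreover there are a neighborhood $V\subset U$ of $x$ and $\delta>0$ with $\delta_+(y)>\delta$ and $\delta_-(y)<-\delta$ for all $y\in V\cap S$; (c) $\Phi(y,[a,b])\cap S$ is compact for all $y\in X$ and $a,b\in\mathbb{R}$; (d) for each $x\in X$ there are $t_+>0$ and $t_-<0$ with $\Phi(x,t_+)\in S$ and $\Phi(x,t_-)\in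 S$. Then the first return time $T_\Phi(x)=\min\{t>0 : \Phi(x,t)\in S\}$ exists for every $x\in S$, and the Poincaré map $f=P\Phi: S\to S$, $f(x)=\Phi(x,T_\Phi(x))$, is a homeomorphism. Let $S_f=S\times[0,1]/\!\sim$ be its mapping torus, where $\sim$ is the smallest equivalence relation with $(x,1)\sim(f(x),0)$, let $\Sigma f$ be the suspension flow on $S_f$, given by $\Sigma f([x,t],s)=[f^m(x),s+t-m]$ with $m=\lfloor s+t\rfloor$, and let $(S_f)_0=\{[x,0]: x\in S\}$. Then $S_f$ is a topological manifold of dimension $n$, $(S_f)_0$ is a global Poincaré section of $\Sigma f$, and $(\Phi,X,S)$ is topologically equivalent to $(\Sigma f,S_f,(S_f)_0)$ by an equivalence preserving the sections. Here a weak morphism $(\Phi,X)\to(\Psi,Y)$ is a pair $(h,\tau)$ of a continuous map $h:X\to Y$ and a map $\tau:X\times\mathbb{R}\to\mathbb{R}$ such that $h(\Phi(x,t))=\Psi(h(x),\tau(x,t))$ and each $\tau(x,-)$ is an increasing homeomorphism of $\mathbb{R}$ with $\tau(x,0)=0$. It preserves sections $S\subset X$, $S'\subset Y$ if $S=h^{-1}(S')$.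 The composition of $(h_1,\tau_1)$ followed by $(h_2,\tau_2)$ is $(h_2\circ h_1,\ (x,t)\mapsto\tau_2(h_1(x),\tau_1(x,t)))$, and the identity is $(\mathrm{id}_X,\ (x,t)\mapsto t)$. A topological equivalence preserving sections is a section-preserving weak morphism that has a section-preserving weak morphism as two-sided inverse for this composition. -/

import Mathlib

open Set Topology

/-- `X` is a topological manifold (without boundary) of dimension `n`: Hausdorff, second countable
and covered by charts with values in `ℝⁿ`. -/
structure IsTopologicalManifold (n : ℕ) (X : Type*) [TopologicalSpace X] : Prop where
  t2 : T2Space X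
  secondCountable : SecondCountableTopology X
  locallyEuclidean : Nonempty (ChartedSpace (EuclideanSpace ℝ (Fin n)) X)

section Transversality

variable {X : Type*} [TopologicalSpace X]

/-- There is a homeomorphism of `U` onto the open unit ball `B` of `ℝⁿ` which carries `U ∩ S` onto
`B ∩ (ℝⁿ⁻¹ × {0})`; the condition on `i` selects the last coordinate. -/
def IsFlatBall (n : ℕ) (S U : Set X) : Prop :=
  ∃ φ : U ≃ₜ Metric.ball (0 : EuclideanSpace ℝ (Fin n)) 1,
    ∀ u : U, (u : X) ∈ S ↔
      ∀ i : Fin n, (i : ℕ) + 1 = n → (φ u : EuclideanSpace ℝ (Fin n)) i = 0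

/-- `S` is a closed, locally flat submanifold of codimension one, without boundary, of the
`n`-dimensional manifold `X`. -/
structure IsLocallyFlatHypersurface (n : ℕ) (S : Set X) : Prop where
  isClosed : IsClosed S
  locallyFlat : ∀ x ∈ S, ∃ U ∈ 𝓝 x, IsFlatBall n S U

/-- `S` is topologically transversal to the flow `Φ` on the `n`-dimensional manifold `X`. -/
structure IsTopologicallyTransversal (n : ℕ) (Φ : Flow ℝ X) (S : Set X) : Prop where
  hypersurface : IsLocallyFlatHypersurface n S
  /-- Near each of its points, `S` is crossed by the orbits from one side to the other, during
  times `δm x < 0 < δp x` that are locally bounded away from `0`. -/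
  crossing : ∃ δp δm : X → ℝ, ∀ x ∈ S, 0 < δp x ∧ δm x < 0 ∧
    ∃ U ∈ 𝓝 x, IsFlatBall n S U ∧
      (∃ a ∈ U \ S, ∃ b ∈ U \ S,
        connectedComponentIn (U \ S) a ≠ connectedComponentIn (U \ S) b ∧
        (∀ t ∈ Ico (δm x) 0, Φ t x ∈ connectedComponentIn (U \ S) a) ∧
        (∀ t ∈ Ioc 0 (δp x), Φ t x ∈ connectedComponentIn (U \ S) b)) ∧
      ((fun t => Φ t x) '' Icc (δm x) (δp x)) ∩ S = {x} ∧
      ∃ V ∈ 𝓝 x, V ⊆ U ∧ ∃ δ > 0, ∀ y ∈ V ∩ S, δ < δp y ∧ δm y < -δ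
  compact_inter : ∀ (y : X) (a b : ℝ), IsCompact (((fun t => Φ t y) '' Icc a b) ∩ S)

/-- `S` is a global Poincaré section of the flow `Φ` on the `n`-dimensional manifold `X`. -/
structure IsGlobalPoincareSection (n : ℕ) (Φ : Flow ℝ X) (S : Set X) : Prop where
  transversal : IsTopologicallyTransversal n Φ S
  hits : ∀ x : X, (∃ t > 0, Φ t x ∈ S) ∧ (∃ t < 0, Φ t x ∈ S)

/-- `f` is the Poincaré (first return) map of `Φ` on `S`: `f x = Φ (T x) x`, where `T x` is the
smallest positive time at which the orbit of `x` is in `S`. -/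
def IsPoincareMap (Φ : Flow ℝ X) (S : Set X) (f : S → S) : Prop :=
  ∀ x : S, ∃ T : ℝ, IsLeast {t : ℝ | 0 < t ∧ Φ t x ∈ S} T ∧ (f x : X) = Φ T x

end Transversality

section WeakMorphisms

variable {X Y Z : Type*} [TopologicalSpace X] [TopologicalSpace Y] [TopologicalSpace Z]

/-- Weak morphisms `(h, τ)` of flows. -/
@[ext]
structure WeakMorphism (Φ : Flow ℝ X) (Ψ : Flow ℝ Y) where
  /-- the space part `h` -/
  toFun : X → Y
  /-- the time part `τ` -/
  time : X → ℝ → ℝ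
  continuous_toFun : Continuous toFun
  map_flow : ∀ x t, toFun (Φ t x) = Ψ (time x t) (toFun x)
  time_isHomeomorph : ∀ x, IsHomeomorph (time x)
  time_strictMono : ∀ x, StrictMono (time x)
  time_zero : ∀ x, time x 0 = 0

/-- The identity weak morphism. -/
def WeakMorphism.id (Φ : Flow ℝ X) : WeakMorphism Φ Φ where
  toFun x := x
  time _ t := t
  continuous_toFun := continuous_id
  map_flow _ _ := rfl
  time_isHomeomorph _ := IsHomeomorph.id
  time_strictMono _ := strictMono_id
  time_zero _ := rfl

/-- The composition of weak morphisms (first `k`, then `h`). -/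
def WeakMorphism.comp {Φ : Flow ℝ X} {Ψ : Flow ℝ Y} {Θ : Flow ℝ Z}
    (h : WeakMorphism Ψ Θ) (k : WeakMorphism Φ Ψ) : WeakMorphism Φ Θ where
  toFun x := h.toFun (k.toFun x)
  time x t := h.time (k.toFun x) (k.time x t)
  continuous_toFun := h.continuous_toFun.comp k.continuous_toFun
  map_flow x t := by rw [k.map_flow, h.map_flow]
  time_isHomeomorph x := (h.time_isHomeomorph _).comp (k.time_isHomeomorph x)
  time_strictMono x := (h.time_strictMono _).comp (k.time_strictMono x)
  time_zero x := by rw [k.time_zero, h.time_zero]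

/-- The weak morphism preserves the sections `S` and `S'`. -/
def WeakMorphism.PreservesSection {Φ : Flow ℝ X} {Ψ : Flow ℝ Y} (h : WeakMorphism Φ Ψ)
    (S : Set X) (S' : Set Y) : Prop :=
  S = h.toFun ⁻¹' S'

/-- `(Φ, X, S)` and `(Ψ, Y, S')` are topologically equivalent: they are isomorphic through weak
morphisms that preserve the sections. -/
def TopologicallyEquivalent (Φ : Flow ℝ X) (S : Set X) (Ψ : Flow ℝ Y) (S' : Set Y) : Prop :=
  ∃ (h : WeakMorphism Φ Ψ) (k : WeakMorphism Ψ Φ),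
    h.PreservesSection S S' ∧ k.PreservesSection S' S ∧
    k.comp h = WeakMorphism.id Φ ∧ h.comp k = WeakMorphism.id Ψ

end WeakMorphisms

section Suspension

variable {X : Type*} [TopologicalSpace X]

/-- The relation `(x, 1) ∼ (f x, 0)` on `X × [0, 1]`. -/
def mappingTorusRel (f : X ≃ₜ X) (p q : X × unitInterval) : Prop :=
  p.2 = 1 ∧ q = (f p.1, 0)

/-- The mapping torus of `f`: the quotient of `X × [0, 1]` by the smallest equivalence relation
with `(x, 1) ∼ (f x, 0)`. -/
def MappingTorus (f : X ≃ₜ X) : Type _ := Quot (mappingTorusRel f)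

instance (f : X ≃ₜ X) : TopologicalSpace (MappingTorus f) :=
  inferInstanceAs (TopologicalSpace (Quot (mappingTorusRel f)))

namespace MappingTorus

/-- The class of `(x, t)`. -/
def mk (f : X ≃ₜ X) (p : X × unitInterval) : MappingTorus f := Quot.mk _ p

/-- The section `{[x, 0] | x ∈ X}`. -/
def zeroSection (f : X ≃ₜ X) : Set (MappingTorus f) := range fun x : X => mk f (x, 0)

theorem isQuotientMap_mk (f : X ≃ₜ X) : IsQuotientMap (mk f) := isQuotientMap_quot_mk

theorem mk_one (f : X ≃ₜ X) (x : X) : mk f (x, 1) = mk f (f x, 0) := Quot.sound ⟨rfl, rfl⟩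

/-- The point `[fⁿ x, u - n]` of the mapping torus, where `n = ⌊u⌋`. -/
noncomputable def unroll (f : X ≃ₜ X) (u : ℝ) (x : X) : MappingTorus f :=
  mk f ((f ^ ⌊u⌋) x, ⟨Int.fract u, Int.fract_nonneg u, (Int.fract_lt_one u).le⟩)

theorem unroll_eq (f : X ≃ₜ X) (x : X) (u : ℝ) (n : ℤ) (h : u - n ∈ unitInterval) :
    unroll f u x = mk f ((f ^ n) x, ⟨u - n, h⟩) := by
  rcases h.2.lt_or_eq with h1 | h1
  · have hn : ⌊u⌋ = n := Int.floor_eq_iff.2 ⟨by linarith [h.1], by linarith⟩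
    subst hn
    rfl
  · have hu : u = ((n + 1 : ℤ) : ℝ) := by push_cast; linarith
    have e1 : (⟨u - n, h⟩ : unitInterval) = 1 := Subtype.ext h1
    have e2 : (⟨Int.fract u, Int.fract_nonneg u, (Int.fract_lt_one u).le⟩ : unitInterval) = 0 :=
      Subtype.ext ((congrArg Int.fract hu).trans (Int.fract_intCast _))
    have e3 : ⌊u⌋ = n + 1 := by rw [hu]; exact Int.floor_intCast _
    have e4 : unroll f u x = mk f ((f ^ ⌊u⌋) x, 0) := congrArg (fun r => mk f (_, r)) e2
    rw [e1, mk_one, e4, e3, add_comm, zpow_add, zpow_one]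
    rfl

theorem unroll_coe (f : X ≃ₜ X) (x : X) (t : unitInterval) :
    unroll f (t : ℝ) x = mk f (x, t) := by
  have h : (t : ℝ) - (0 : ℤ) ∈ unitInterval := by simp
  rw [unroll_eq f x t 0 h]
  simp

theorem unroll_add_one (f : X ≃ₜ X) (x : X) (u : ℝ) :
    unroll f (u + 1) x = unroll f u (f x) := by
  simp only [unroll, Int.floor_add_one, Int.fract_add_one, zpow_add, zpow_one]
  rfl

theorem unroll_unroll (f : X ≃ₜ X) (x : X) (s u : ℝ) :
    unroll f (s + Int.fract u) ((f ^ ⌊u⌋) x) = unroll f (s + u) x := by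
  have h : s + u = s + Int.fract u + (⌊u⌋ : ℤ) := by
    rw [add_assoc, Int.fract_add_floor]
  rw [h]
  simp only [unroll, Int.floor_add_intCast, Int.fract_add_intCast, zpow_add]
  rfl

theorem continuous_unroll (f : X ≃ₜ X) :
    Continuous fun p : ℝ × X => unroll f p.1 p.2 := by
  have hlf : LocallyFinite fun n : ℤ => (Prod.fst : ℝ × X → ℝ) ⁻¹' Icc (n : ℝ) (n + 1) := by
    refine LocallyFinite.preimage_continuous (fun x => ?_) continuous_fst
    refine ⟨Ioo (x - 1) (x + 1), Ioo_mem_nhds (by linarith) (by linarith), ?_⟩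
    refine (Set.finite_Icc (⌊x⌋ - 3) (⌊x⌋ + 3)).subset ?_
    rintro n ⟨y, ⟨h1, h2⟩, h3, h4⟩
    have := Int.floor_le x
    have := Int.lt_floor_add_one x
    constructor
    · have : ((⌊x⌋ - 3 : ℤ) : ℝ) ≤ n := by push_cast; linarith
      exact_mod_cast this
    · have : (n : ℝ) ≤ ((⌊x⌋ + 3 : ℤ) : ℝ) := by push_cast; linarith
      exact_mod_cast this
  refine hlf.continuous ?_ (fun n => isClosed_Icc.preimage continuous_fst) fun n => ?_
  · refine eq_univ_of_forall fun p => mem_iUnion.2 ⟨⌊p.1⌋, Int.floor_le _, ?_⟩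
    exact (Int.lt_floor_add_one _).le
  · have hc : Continuous fun p : ℝ × X =>
        mk f ((f ^ n) p.2, projIcc (0 : ℝ) 1 zero_le_one (p.1 - n)) :=
      (isQuotientMap_mk f).continuous.comp
        (((f ^ n).continuous.comp continuous_snd).prodMk
          (continuous_projIcc.comp (continuous_fst.sub continuous_const)))
    refine hc.continuousOn.congr fun p hp => ?_
    have h : p.1 - n ∈ unitInterval := ⟨by linarith [hp.1], by linarith [hp.2]⟩
    simp only [unroll_eq f p.2 p.1 n h, projIcc_of_mem zero_le_one h]

end MappingTorus

open MappingTorus in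
/-- The suspension flow of `f`: in time `s`, the point `[x, t]` moves to `[fⁿ x, s + t - n]`, where
`n = ⌊s + t⌋`. -/
noncomputable def suspensionFlow (f : X ≃ₜ X) : Flow ℝ (MappingTorus f) where
  toFun s := Quot.lift (fun p => unroll f (s + p.2) p.1) (by
    rintro ⟨x, t⟩ q ⟨ht, rfl⟩
    obtain rfl : t = 1 := ht
    simpa using unroll_add_one f x s)
  cont' := by
    refine (isQuotientMap_mk f).continuous_lift_prod_right ?_
    exact (continuous_unroll f).comp
      (f := fun q : ℝ × (X × unitInterval) => ((q.1 + (q.2.2 : ℝ), q.2.1) : ℝ × X)) (by fun_prop)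
  map_add' s t p := by
    induction p using Quot.ind with
    | mk p =>
      change unroll f (s + t + p.2) p.1 = unroll f (s + Int.fract (t + (p.2 : ℝ))) _
      rw [unroll_unroll, add_assoc]
  map_zero' p := by
    induction p using Quot.ind with
    | mk p =>
      change unroll f (0 + p.2) p.1 = mk f p
      rw [zero_add, unroll_coe]

end Suspension

/-!
By the intermediate value theorem, an orbit that crosses `S` from one side to the other forces all
nearby orbits to hit `S` at nearby times. Together with the local lower bound on the gaps between
hits, this makes the return time `T` continuous on `S`, and the first return of the reversed flow
is the inverse of the Poincaré map `f`. It also makes `(x, t) ↦ Φ (t * T x) x` a proper map from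
`S × [0, 1]` onto `X`, which identifies exactly the points `(x, 1)` and `(f x, 0)`: the mapping
torus of `f` is homeomorphic to `X`. The corresponding time change is the piecewise linear
interpolation of the two-sided Birkhoff sums of `T`. As it depends continuously on the base point
along the section, the transversality of `S` can be pulled back to the suspension flow.
-/

open Filter

section OrderAndConnectedness

theorem isHomeomorph_of_strictMono_of_surjective {α β : Type*} [LinearOrder α] [LinearOrder β]
    [TopologicalSpace α] [OrderTopology α] [TopologicalSpace β] [OrderTopology β] {g : α → β}
    (hg : StrictMono g) (hs : Function.Surjective g) : IsHomeomorph g :=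
  (hg.orderIsoOfSurjective g hs).toHomeomorph.isHomeomorph

theorem exists_int_le_lt_add_one {α : Type*} [LinearOrder α] {s : ℤ → α} (hs : StrictMono s) {r : α}
    (hle : ∃ m, s m ≤ r) (hlt : ∃ m, r < s m) : ∃ m, s m ≤ r ∧ r < s (m + 1) := by
  obtain ⟨N, hN⟩ := hlt
  obtain ⟨m, hm, hmax⟩ := Int.exists_greatest_of_bdd (P := fun m => s m ≤ r)
    ⟨N, fun m hm => (hs.lt_iff_lt.1 (hm.trans_lt hN)).le⟩ hle
  exact ⟨m, hm, lt_of_not_ge fun h => (hmax _ h).not_gt (lt_add_one m)⟩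

variable {X Y : Type*} [TopologicalSpace X] [TopologicalSpace Y]

theorem connectedComponentIn_eq_inter_pos {F : Set X} {g : X → ℝ} (hg : ContinuousOn g F)
    (hg0 : ∀ y ∈ F, g y ≠ 0) (hpos : IsPreconnected (F ∩ {y | 0 < g y})) {a : X} (ha : a ∈ F)
    (hga : 0 < g a) : connectedComponentIn F a = F ∩ {y | 0 < g y} := by
  refine Subset.antisymm (fun y hy => ⟨connectedComponentIn_subset F a hy, ?_⟩)
    (hpos.subset_connectedComponentIn ⟨ha, hga⟩ inter_subset_left)
  by_contra hgy
  obtain ⟨z, hz, hgz⟩ := isPreconnected_connectedComponentIn.intermediate_value hy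
    (mem_connectedComponentIn ha) (hg.mono (connectedComponentIn_subset F a)) ⟨not_lt.1 hgy, hga.le⟩
  exact hg0 z (connectedComponentIn_subset F a hz) hgz

theorem exists_separating_sign {F : Set X} {g : X → ℝ} (hg : ContinuousOn g F)
    (hg0 : ∀ y ∈ F, g y ≠ 0) (hpos : IsPreconnected (F ∩ {y | 0 < g y}))
    (hneg : IsPreconnected (F ∩ {y | 0 < -g y})) {a b : X} (ha : a ∈ F) (hb : b ∈ F)
    (hab : connectedComponentIn F a ≠ connectedComponentIn F b) :
    ∃ σ : ℝ, σ ≠ 0 ∧ (∀ y ∈ connectedComponentIn F a, σ * g y < 0) ∧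
      ∀ y ∈ connectedComponentIn F b, 0 < σ * g y := by
  have eq_pos {c : X} (hc : c ∈ F) := connectedComponentIn_eq_inter_pos hg hg0 hpos hc
  have eq_neg {c : X} (hc : c ∈ F) :=
    connectedComponentIn_eq_inter_pos hg.neg (fun y hy => neg_ne_zero.2 (hg0 y hy)) hneg hc
  simp only [Pi.neg_apply, Left.neg_pos_iff] at eq_neg
  rcases (hg0 a ha).lt_or_gt with hga | hga <;> rcases (hg0 b hb).lt_or_gt with hgb | hgb
  · exact absurd ((eq_neg ha hga).trans (eq_neg hb hgb).symm) hab
  · rw [eq_neg ha hga, eq_pos hb hgb]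
    exact ⟨1, one_ne_zero, fun y hy => by simpa using hy.2, fun y hy => by simpa using hy.2⟩
  · rw [eq_pos ha hga, eq_neg hb hgb]
    exact ⟨-1, by simp, fun y hy => by simpa using hy.2, fun y hy => by simpa using hy.2⟩
  · exact absurd ((eq_pos ha hga).trans (eq_pos hb hgb).symm) hab

theorem preimage_connectedComponentIn_of_isHomeomorph {e : Y → X} (he : IsHomeomorph e) {F : Set X}
    {y : Y} (hy : e y ∈ F) :
    e ⁻¹' connectedComponentIn F (e y) = connectedComponentIn (e ⁻¹' F) y := by
  have h := he.homeomorph.image_connectedComponentIn (s := e ⁻¹' F) (x := y) hy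
  simp only [IsHomeomorph.homeomorph_apply, image_preimage_eq F he.surjective] at h
  rw [← h, preimage_image_eq _ he.injective]

theorem isPreconnected_ball_inter_pos {E : Type*} [NormedAddCommGroup E] [NormedSpace ℝ E] (c : E)
    (r : ℝ) (ℓ : E →L[ℝ] ℝ) : IsPreconnected {z : Metric.ball c r | 0 < ℓ z} := by
  rw [← IsInducing.subtypeVal.isPreconnected_image]
  have hconvex : Convex ℝ (Metric.ball c r ∩ {z | 0 < ℓ z}) :=
    (convex_ball c r).inter (convex_halfSpace_gt ℓ.isLinear 0)
  convert hconvex.isPreconnected using 1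
  ext z
  simp [and_comm]

end OrderAndConnectedness

section FlatBalls

variable {X Y : Type*} [TopologicalSpace X] [TopologicalSpace Y] {n : ℕ} {S U : Set X}

theorem exists_clm_eq_zero_iff_last_eq_zero (n : ℕ) :
    ∃ ℓ : EuclideanSpace ℝ (Fin n) →L[ℝ] ℝ,
      ∀ z, ℓ z = 0 ↔ ∀ i : Fin n, (i : ℕ) + 1 = n → z i = 0 := by
  cases n with
  | zero => exact ⟨0, fun z => by simp⟩
  | succ m =>
    refine ⟨EuclideanSpace.proj (Fin.last m), fun z => ⟨fun h i hi => ?_, fun h => h _ (by simp)⟩⟩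
    rwa [show i = Fin.last m from Fin.ext (by simpa using hi)]

namespace IsFlatBall

theorem preimage (hU : IsFlatBall n S U) {e : Y → X} (he : IsHomeomorph e) :
    IsFlatBall n (e ⁻¹' S) (e ⁻¹' U) := by
  obtain ⟨φ, hφ⟩ := hU
  exact ⟨(he.homeomorph.subtype fun _ => Iff.rfl).trans φ, fun u => hφ ⟨e u, u.2⟩⟩

theorem exists_height (hU : IsFlatBall n S U) :
    ∃ g : X → ℝ, ContinuousOn g U ∧ (∀ y ∈ U, y ∈ S ↔ g y = 0) ∧
      IsPreconnected (U ∩ {y | 0 < g y}) ∧ IsPreconnected (U ∩ {y | 0 < -g y}) := by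
  obtain ⟨φ, hφ⟩ := hU
  obtain ⟨ℓ, hℓ⟩ := exists_clm_eq_zero_iff_last_eq_zero n
  let g : X → ℝ := Function.extend Subtype.val (fun u : U => ℓ (φ u)) 0
  have hg (u : U) : g u = ℓ (φ u) := Subtype.val_injective.extend_apply _ _ u
  have half (σ : ℝ) : IsPreconnected (U ∩ {y | 0 < σ * g y}) := by
    convert (isPreconnected_ball_inter_pos 0 1 (σ • ℓ)).image (fun z => (φ.symm z : X))
      (by fun_prop) using 1
    ext y
    constructor
    · rintro ⟨hy, hpos⟩
      exact ⟨φ ⟨y, hy⟩, by simpa [← hg] using hpos, by simp⟩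
    · rintro ⟨z, hz, rfl⟩
      exact ⟨(φ.symm z).2, by simpa [hg] using hz⟩
  refine ⟨g, ?_, fun y hy => ?_, by simpa using half 1, by simpa using half (-1)⟩
  · rw [continuousOn_iff_continuous_domRestrict, show U.domRestrict g = _ from funext hg]
    fun_prop
  · rw [hg ⟨y, hy⟩, hℓ]
    exact hφ ⟨y, hy⟩

theorem exists_separating_function (hU : IsFlatBall n S U) {a b : X} (ha : a ∈ U \ S)
    (hb : b ∈ U \ S) (hab : connectedComponentIn (U \ S) a ≠ connectedComponentIn (U \ S) b) :
    ∃ g : X → ℝ, ContinuousOn g U ∧ (∀ y ∈ U, y ∈ S ↔ g y = 0) ∧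
      (∀ y ∈ connectedComponentIn (U \ S) a, g y < 0) ∧
      ∀ y ∈ connectedComponentIn (U \ S) b, 0 < g y := by
  obtain ⟨g, hgc, hgS, hpos, hneg⟩ := hU.exists_height
  have hg0 (y : X) (hy : y ∈ U \ S) : g y ≠ 0 := fun h => hy.2 ((hgS y hy.1).2 h)
  have diff_inter {h : X → ℝ} (hh : ∀ y ∈ U, y ∈ S → h y = 0) :
      U ∩ {y | 0 < h y} = U \ S ∩ {y | 0 < h y} := by
    ext y
    exact ⟨fun hy => ⟨⟨hy.1, fun hyS => hy.2.ne' (hh y hy.1 hyS)⟩, hy.2⟩,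
      fun hy => ⟨hy.1.1, hy.2⟩⟩
  rw [diff_inter fun y hy hyS => (hgS y hy).1 hyS] at hpos
  rw [diff_inter fun y hy hyS => neg_eq_zero.2 ((hgS y hy).1 hyS)] at hneg
  obtain ⟨σ, hσ, hσa, hσb⟩ :=
    exists_separating_sign (hgc.mono sdiff_subset) hg0 hpos hneg ha hb hab
  exact ⟨fun y => σ * g y, continuousOn_const.mul hgc, fun y hy => by simp [hgS y hy, hσ], hσa, hσb⟩

end IsFlatBall

end FlatBalls

section Crossings

variable {X : Type*} [TopologicalSpace X] {n : ℕ} {Φ : Flow ℝ X} {S : Set X}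

/-- In a flat ball around `x`, the orbit of `x` is on one side of `S` during the times `[p, 0)` and
on the other side during the times `(0, q]`. This is the pointwise part of topological
transversality; `x` itself is not required to lie in `S`. -/
def CrossesDuring (n : ℕ) (Φ : Flow ℝ X) (S : Set X) (x : X) (p q : ℝ) : Prop :=
  ∃ U ∈ 𝓝 x, IsFlatBall n S U ∧ ∃ a ∈ U \ S, ∃ b ∈ U \ S,
    connectedComponentIn (U \ S) a ≠ connectedComponentIn (U \ S) b ∧
    (∀ t ∈ Ico p 0, Φ t x ∈ connectedComponentIn (U \ S) a) ∧
    (∀ t ∈ Ioc 0 q, Φ t x ∈ connectedComponentIn (U \ S) b)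

theorem CrossesDuring.eq_zero_of_flow_mem {x : X} {p q t : ℝ} (h : CrossesDuring n Φ S x p q)
    (ht : t ∈ Icc p q) (htS : Φ t x ∈ S) : t = 0 := by
  obtain ⟨U, -, -, a, -, b, -, -, hca, hcb⟩ := h
  rcases lt_trichotomy t 0 with h0 | h0 | h0
  · exact absurd htS (connectedComponentIn_subset _ _ (hca t ⟨ht.1, h0⟩)).2
  · exact h0
  · exact absurd htS (connectedComponentIn_subset _ _ (hcb t ⟨h0, ht.2⟩)).2

theorem isTopologicallyTransversal_iff :
    IsTopologicallyTransversal n Φ S ↔ IsClosed S ∧ ∃ δp δm : X → ℝ, ∀ x ∈ S,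
      0 < δp x ∧ δm x < 0 ∧ CrossesDuring n Φ S x (δm x) (δp x) ∧
      ∃ δ > 0, ∀ᶠ y in 𝓝[S] x, δ < δp y ∧ δm y < -δ := by
  constructor
  · rintro ⟨hS, ⟨δp, δm, h⟩, -⟩
    refine ⟨hS.isClosed, δp, δm, fun x hx => ?_⟩
    obtain ⟨hp, hm, U, hU, hflat, ⟨a, ha, b, hb, hcross⟩, -, V, hV, -, δ, hδ, hbound⟩ := h x hx
    exact ⟨hp, hm, ⟨U, hU, hflat, a, ha, b, hb, hcross⟩, δ, hδ,
      eventually_nhdsWithin_iff.2 (mem_of_superset hV fun y hyV hyS => hbound y ⟨hyV, hyS⟩)⟩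
  · rintro ⟨hcl, δp, δm, h⟩
    refine ⟨⟨hcl, fun x hx => ?_⟩, ⟨δp, δm, fun x hx => ?_⟩, fun y a b =>
      (isCompact_Icc.image (by fun_prop)).inter_right hcl⟩
    · obtain ⟨-, -, ⟨U, hU, hflat, -⟩, -⟩ := h x hx
      exact ⟨U, hU, hflat⟩
    · obtain ⟨hp, hm, hcross, δ, hδ, hbound⟩ := h x hx
      have honly : (fun t => Φ t x) '' Icc (δm x) (δp x) ∩ S = {x} := by
        refine Subset.antisymm ?_ (singleton_subset_iff.2 ⟨⟨0, ⟨hm.le, hp.le⟩, by simp⟩, hx⟩)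
        rintro _ ⟨⟨t, ht, rfl⟩, htS⟩
        simp [hcross.eq_zero_of_flow_mem ht htS]
      obtain ⟨U, hU, hflat, a, ha, b, hb, hside⟩ := hcross
      refine ⟨hp, hm, U, hU, hflat, ⟨a, ha, b, hb, hside⟩, honly, _,
        inter_mem hU (eventually_nhdsWithin_iff.1 hbound), inter_subset_left, δ, hδ,
        fun y hy => hy.1.2 hy.2⟩

end Crossings

section TimeChange

variable {X Y : Type*} [TopologicalSpace X] [TopologicalSpace Y] {n : ℕ} {Φ : Flow ℝ X}
  {Ψ : Flow ℝ Y} {S : Set X}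

namespace WeakMorphism

theorem time_pos_iff (k : WeakMorphism Ψ Φ) {y : Y} {t : ℝ} : 0 < k.time y t ↔ 0 < t := by
  rw [← (k.time_strictMono y).lt_iff_lt (b := t), k.time_zero]

theorem time_neg_iff (k : WeakMorphism Ψ Φ) {y : Y} {t : ℝ} : k.time y t < 0 ↔ t < 0 := by
  rw [← (k.time_strictMono y).lt_iff_lt (a := t), k.time_zero]

/-- The reparametrization of the orbit of `y`, as an order isomorphism. -/
noncomputable def timeOrderIso (k : WeakMorphism Ψ Φ) (y : Y) : ℝ ≃o ℝ :=
  (k.time_strictMono y).orderIsoOfSurjective _ (k.time_isHomeomorph y).surjective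

theorem time_timeOrderIso_symm (k : WeakMorphism Ψ Φ) (y : Y) (t : ℝ) :
    k.time y ((k.timeOrderIso y).symm t) = t :=
  (k.timeOrderIso y).apply_symm_apply t

theorem timeOrderIso_symm_time (k : WeakMorphism Ψ Φ) (y : Y) (t : ℝ) :
    (k.timeOrderIso y).symm (k.time y t) = t :=
  (k.timeOrderIso y).symm_apply_apply t

/-- The inverse of a weak morphism whose space part is a homeomorphism. -/
noncomputable def inverse (k : WeakMorphism Ψ Φ) (hk : IsHomeomorph k.toFun) :
    WeakMorphism Φ Ψ where
  toFun := hk.homeomorph.symm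
  time x := (k.timeOrderIso (hk.homeomorph.symm x)).symm
  continuous_toFun := hk.homeomorph.symm.continuous
  map_flow x t := by
    refine hk.injective ?_
    rw [k.map_flow, time_timeOrderIso_symm]
    simp only [← hk.homeomorph_apply, Homeomorph.apply_symm_apply]
  time_isHomeomorph x :=
    (k.timeOrderIso (hk.homeomorph.symm x)).symm.toHomeomorph.isHomeomorph
  time_strictMono x := OrderIso.strictMono _
  time_zero x := by
    simpa only [k.time_zero] using k.timeOrderIso_symm_time (hk.homeomorph.symm x) 0

theorem comp_inverse (k : WeakMorphism Ψ Φ) (hk : IsHomeomorph k.toFun) :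
    k.comp (k.inverse hk) = WeakMorphism.id Φ := by
  ext x t
  · exact hk.homeomorph.apply_symm_apply x
  · exact k.time_timeOrderIso_symm _ t

theorem inverse_comp (k : WeakMorphism Ψ Φ) (hk : IsHomeomorph k.toFun) :
    (k.inverse hk).comp k = WeakMorphism.id Ψ := by
  have hsymm (y : Y) : hk.homeomorph.symm (k.toFun y) = y := hk.homeomorph.symm_apply_apply y
  ext y t
  · exact hsymm y
  · change (k.timeOrderIso (hk.homeomorph.symm (k.toFun y))).symm (k.time y t) = t
    rw [hsymm, timeOrderIso_symm_time]

theorem topologicallyEquivalent (k : WeakMorphism Ψ Φ) (hk : IsHomeomorph k.toFun) (S : Set X) :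
    TopologicallyEquivalent Φ S Ψ (k.toFun ⁻¹' S) := by
  refine ⟨k.inverse hk, k, ?_, rfl, k.comp_inverse hk, k.inverse_comp hk⟩
  rw [PreservesSection, ← preimage_comp]
  exact (congrArg (· ⁻¹' S) (funext hk.homeomorph.apply_symm_apply)).symm

theorem exists_pos_eventually_time_lt (k : WeakMorphism Ψ Φ) {A : Set Y}
    (hk : ∀ t, ContinuousOn (fun y => k.time y t) A) {y : Y} (hy : y ∈ A) {δ : ℝ} (hδ : 0 < δ) :
    ∃ ε > 0, ∀ᶠ z in 𝓝[A] y, k.time z ε < δ ∧ -δ < k.time z (-ε) := by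
  have hcont : Continuous (k.time y) := (k.time_isHomeomorph y).continuous
  have hsmall : ∀ᶠ ε in 𝓝[>] (0 : ℝ), k.time y ε < δ ∧ -δ < k.time y (-ε) :=
    nhdsWithin_le_nhds <|
      (hcont.continuousAt.eventually_lt_const (by simpa only [k.time_zero] using hδ)).and
      ((hcont.comp continuous_neg).continuousAt.eventually_const_lt
        (by simpa [k.time_zero] using hδ))
  obtain ⟨ε, ⟨hp, hm⟩, hε⟩ := (hsmall.and self_mem_nhdsWithin).exists
  exact ⟨ε, hε, ((hk ε y hy).eventually_lt_const hp).and ((hk (-ε) y hy).eventually_const_lt hm)⟩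

end WeakMorphism

theorem TopologicallyEquivalent.nonempty_homeomorph {S' : Set Y}
    (h : TopologicallyEquivalent Φ S Ψ S') : Nonempty (X ≃ₜ Y) := by
  obtain ⟨h, k, -, -, hkh, hhk⟩ := h
  exact ⟨{
    toFun := h.toFun
    invFun := k.toFun
    left_inv := congrFun (congrArg WeakMorphism.toFun hkh)
    right_inv := congrFun (congrArg WeakMorphism.toFun hhk)
    continuous_toFun := h.continuous_toFun
    continuous_invFun := k.continuous_toFun }⟩

theorem IsTopologicalManifold.of_homeomorph (hX : IsTopologicalManifold n X) (e : X ≃ₜ Y) :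
    IsTopologicalManifold n Y where
  t2 := have := hX.t2; e.t2Space
  secondCountable := have := hX.secondCountable; e.symm.secondCountableTopology
  locallyEuclidean := by
    obtain ⟨c⟩ := hX.locallyEuclidean
    exact ⟨e.chartedSpace⟩

theorem CrossesDuring.preimage {k : WeakMorphism Ψ Φ} (hk : IsHomeomorph k.toFun) {y : Y} {p q : ℝ}
    (h : CrossesDuring n Φ S (k.toFun y) (k.time y p) (k.time y q)) :
    CrossesDuring n Ψ (k.toFun ⁻¹' S) y p q := by
  obtain ⟨U, hU, hflat, a', ha, b', hb, hab, hca, hcb⟩ := h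
  obtain ⟨a, rfl⟩ := hk.surjective a'
  obtain ⟨b, rfl⟩ := hk.surjective b'
  have mono {s t : ℝ} : k.time y s ≤ k.time y t ↔ s ≤ t := (k.time_strictMono y).le_iff_le
  refine ⟨_, hk.continuous.continuousAt.preimage_mem_nhds hU, hflat.preimage hk, a, ha, b, hb, ?_⟩
  rw [← preimage_sdiff, ← preimage_connectedComponentIn_of_isHomeomorph hk ha,
    ← preimage_connectedComponentIn_of_isHomeomorph hk hb]
  refine ⟨hk.surjective.preimage_injective.ne hab, fun t ht => ?_, fun t ht => ?_⟩
  · rw [mem_preimage, k.map_flow]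
    exact hca _ ⟨mono.2 ht.1, k.time_neg_iff.2 ht.2⟩
  · rw [mem_preimage, k.map_flow]
    exact hcb _ ⟨k.time_pos_iff.2 ht.1, mono.2 ht.2⟩

theorem IsTopologicallyTransversal.preimage (hS : IsTopologicallyTransversal n Φ S)
    (k : WeakMorphism Ψ Φ) (hk : IsHomeomorph k.toFun)
    (hτ : ∀ t, ContinuousOn (fun y => k.time y t) (k.toFun ⁻¹' S)) :
    IsTopologicallyTransversal n Ψ (k.toFun ⁻¹' S) := by
  obtain ⟨hcl, δp, δm, hδ⟩ := isTopologicallyTransversal_iff.1 hS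
  refine isTopologicallyTransversal_iff.2 ⟨hcl.preimage hk.continuous,
    fun y => (k.timeOrderIso y).symm (δp (k.toFun y)),
    fun y => (k.timeOrderIso y).symm (δm (k.toFun y)), fun y hy => ?_⟩
  obtain ⟨hp, hm, hcross, δ, hδ0, hbound⟩ := hδ _ hy
  refine ⟨?_, ?_, CrossesDuring.preimage hk ?_, ?_⟩
  · rwa [← k.time_pos_iff (y := y), k.time_timeOrderIso_symm]
  · rwa [← k.time_neg_iff (y := y), k.time_timeOrderIso_symm]
  · rwa [k.time_timeOrderIso_symm, k.time_timeOrderIso_symm]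
  · obtain ⟨ε, hε, hsmall⟩ := k.exists_pos_eventually_time_lt hτ hy hδ0
    have hlift : Tendsto k.toFun (𝓝[k.toFun ⁻¹' S] y) (𝓝[S] k.toFun y) :=
      hk.continuous.continuousWithinAt.tendsto_nhdsWithin fun _ hz => hz
    refine ⟨ε, hε, ?_⟩
    filter_upwards [hsmall, hlift.eventually hbound] with z ⟨hz1, hz2⟩ ⟨hz3, hz4⟩
    rw [← (k.time_strictMono z).lt_iff_lt, ← (k.time_strictMono z).lt_iff_lt (b := -ε),
      k.time_timeOrderIso_symm, k.time_timeOrderIso_symm]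
    exact ⟨hz1.trans hz3, hz4.trans hz2⟩

theorem IsGlobalPoincareSection.preimage (hS : IsGlobalPoincareSection n Φ S)
    (k : WeakMorphism Ψ Φ) (hk : IsHomeomorph k.toFun)
    (hτ : ∀ t, ContinuousOn (fun y => k.time y t) (k.toFun ⁻¹' S)) :
    IsGlobalPoincareSection n Ψ (k.toFun ⁻¹' S) where
  transversal := hS.transversal.preimage k hk hτ
  hits y := by
    obtain ⟨⟨t, ht, htS⟩, s, hs, hsS⟩ := hS.hits (k.toFun y)
    obtain ⟨t, rfl⟩ := (k.time_isHomeomorph y).surjective t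
    obtain ⟨s, rfl⟩ := (k.time_isHomeomorph y).surjective s
    rw [← k.map_flow] at htS hsS
    exact ⟨⟨t, k.time_pos_iff.1 ht, htS⟩, s, k.time_neg_iff.1 hs, hsS⟩

end TimeChange

section BirkhoffSums

variable {X : Type*} [TopologicalSpace X] {f : X ≃ₜ X}

theorem zpow_add_one_apply (f : X ≃ₜ X) (n : ℤ) (x : X) : (f ^ (n + 1)) x = (f ^ n) (f x) := by
  rw [zpow_add_one]
  rfl

theorem apply_zpow_apply (f : X ≃ₜ X) (n : ℤ) (x : X) : f ((f ^ n) x) = (f ^ (n + 1)) x := by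
  rw [add_comm, zpow_one_add]
  rfl

section Group

variable {M : Type*} [AddCommGroup M] {T : X → M}

/-- The Birkhoff sums of `T` along the two-sided orbit of `x`: they extend
`∑ k < n, T (fᵏ x)` from `n : ℕ` to `n : ℤ` as a cocycle, so that for `n < 0` they are equal to
`-∑ n ≤ k < 0, T (fᵏ x)`. One of the two sums in the definition is empty. -/
noncomputable def intBirkhoffSum (f : X ≃ₜ X) (T : X → M) (n : ℤ) (x : X) : M :=
  ∑ k ∈ Finset.Ico 0 n, T ((f ^ k) x) - ∑ k ∈ Finset.Ico n 0, T ((f ^ k) x)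

theorem intBirkhoffSum_zero (x : X) : intBirkhoffSum f T 0 x = 0 := by
  simp [intBirkhoffSum]

theorem intBirkhoffSum_add_one (n : ℤ) (x : X) :
    intBirkhoffSum f T (n + 1) x = intBirkhoffSum f T n x + T ((f ^ n) x) := by
  rcases le_or_gt 0 n with hn | hn
  · rw [intBirkhoffSum, intBirkhoffSum, ← Finset.insert_Ico_right_eq_Ico_add_one hn,
      Finset.sum_insert Finset.right_notMem_Ico, Finset.Ico_eq_empty_of_le hn,
      Finset.Ico_eq_empty_of_le (by lia : 0 ≤ n + 1)]
    abel
  · rw [intBirkhoffSum, intBirkhoffSum, ← Finset.insert_Ico_add_one_left_eq_Ico hn,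
      Finset.sum_insert (by simp), Finset.Ico_eq_empty_of_le hn.le,
      Finset.Ico_eq_empty_of_le (by lia : n + 1 ≤ 0)]
    abel

theorem intBirkhoffSum_add_one' (n : ℤ) (x : X) :
    intBirkhoffSum f T (n + 1) x = T x + intBirkhoffSum f T n (f x) := by
  have step (n : ℤ) : intBirkhoffSum f T (n + 1 + 1) x = T x + intBirkhoffSum f T (n + 1) (f x) ↔
      intBirkhoffSum f T (n + 1) x = T x + intBirkhoffSum f T n (f x) := by
    rw [intBirkhoffSum_add_one, intBirkhoffSum_add_one (x := f x), ← zpow_add_one_apply,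
      ← add_assoc, add_left_inj]
  induction n with
  | zero => rw [intBirkhoffSum_add_one, zpow_zero, Homeomorph.one_apply, add_comm,
      intBirkhoffSum_zero, intBirkhoffSum_zero]
  | succ n ih => exact (step n).2 ih
  | pred n ih => exact (step (-n - 1)).1 (by simpa using ih)

theorem strictMono_intBirkhoffSum [PartialOrder M] [IsOrderedAddMonoid M] (hT : ∀ x, 0 < T x)
    (x : X) : StrictMono fun n => intBirkhoffSum f T n x :=
  strictMono_int_of_lt_succ fun n => by
    rw [intBirkhoffSum_add_one]
    exact lt_add_of_pos_right _ (hT _)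

theorem continuous_intBirkhoffSum [TopologicalSpace M] [IsTopologicalAddGroup M]
    (hT : Continuous T) (n : ℤ) : Continuous (intBirkhoffSum f T n) :=
  (continuous_finsetSum _ fun k _ => hT.comp (f ^ k).continuous).sub
    (continuous_finsetSum _ fun k _ => hT.comp (f ^ k).continuous)

end Group

variable {T : X → ℝ}

/-- The time that the special flow over `f` with roof function `T` needs to make `u` turns, starting
from `x`: the piecewise linear interpolation in `u` of the Birkhoff sums of `T`. -/
noncomputable def roofTime (f : X ≃ₜ X) (T : X → ℝ) (x : X) (u : ℝ) : ℝ :=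
  intBirkhoffSum f T ⌊u⌋ x + Int.fract u * T ((f ^ ⌊u⌋) x)

theorem roofTime_zero (x : X) : roofTime f T x 0 = 0 := by
  simp [roofTime, intBirkhoffSum_zero]

theorem roofTime_add_one (x : X) (u : ℝ) :
    roofTime f T x (u + 1) = T x + roofTime f T (f x) u := by
  simp only [roofTime, Int.floor_add_one, Int.fract_add_one, intBirkhoffSum_add_one',
    zpow_add_one_apply, add_assoc]

theorem roofTime_coe (x : X) (t : unitInterval) : roofTime f T x t = t * T x := by
  rcases t.2.2.lt_or_eq with ht | ht
  · have hfloor : ⌊(t : ℝ)⌋ = 0 := Int.floor_eq_zero_iff.2 ⟨t.2.1, ht⟩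
    have hfract : Int.fract (t : ℝ) = t := Int.fract_eq_self.2 ⟨t.2.1, ht⟩
    simp [roofTime, hfloor, hfract, intBirkhoffSum_zero]
  · simpa [ht, roofTime_zero] using roofTime_add_one (f := f) (T := T) x 0

theorem strictMono_roofTime (hT : ∀ x, 0 < T x) (x : X) : StrictMono (roofTime f T x) := by
  intro u v huv
  rcases (Int.floor_mono huv.le).lt_or_eq with hlt | heq
  · calc roofTime f T x u
        < intBirkhoffSum f T ⌊u⌋ x + T ((f ^ ⌊u⌋) x) :=
          add_lt_add_right (mul_lt_of_lt_one_left (hT _) (Int.fract_lt_one u)) _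
      _ = intBirkhoffSum f T (⌊u⌋ + 1) x := (intBirkhoffSum_add_one _ _).symm
      _ ≤ intBirkhoffSum f T ⌊v⌋ x := (strictMono_intBirkhoffSum hT x).monotone hlt
      _ ≤ roofTime f T x v := le_add_of_nonneg_right (mul_nonneg (Int.fract_nonneg v) (hT _).le)
  · have hfract : Int.fract u < Int.fract v := by
      rw [Int.fract, Int.fract, heq]
      linarith
    rw [roofTime, roofTime, ← heq]
    exact add_lt_add_right (mul_lt_mul_of_pos_right hfract (hT _)) _

theorem surjective_roofTime (hT : ∀ x, 0 < T x) {x : X} (hle : ∀ r, ∃ n, intBirkhoffSum f T n x ≤ r)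
    (hlt : ∀ r, ∃ n, r < intBirkhoffSum f T n x) : Function.Surjective (roofTime f T x) := by
  intro r
  obtain ⟨n, hn, hr⟩ :=
    exists_int_le_lt_add_one (strictMono_intBirkhoffSum hT x) (hle r) (hlt r)
  rw [intBirkhoffSum_add_one, ← sub_lt_iff_lt_add'] at hr
  have hTn : 0 < T ((f ^ n) x) := hT _
  have hθ : (r - intBirkhoffSum f T n x) / T ((f ^ n) x) ∈ Ico 0 1 :=
    ⟨div_nonneg (sub_nonneg.2 hn) hTn.le, (div_lt_one hTn).2 hr⟩
  refine ⟨n + (r - intBirkhoffSum f T n x) / T ((f ^ n) x), ?_⟩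
  rw [roofTime, Int.floor_intCast_add, Int.fract_intCast_add, Int.floor_eq_zero_iff.2 hθ,
    Int.fract_eq_self.2 hθ, add_zero, div_mul_cancel₀ _ hTn.ne', add_sub_cancel]

theorem continuous_roofTime (hT : Continuous T) (u : ℝ) : Continuous fun x => roofTime f T x u :=
  (continuous_intBirkhoffSum hT _).add (continuous_const.mul (hT.comp (f ^ ⌊u⌋).continuous))

end BirkhoffSums

/-- A closed set that is crossed by the flow from one side to the other at each of its points, with
locally positive gaps between the crossings, and that is met by every orbit in the future and in
the past. Of the sides of a hypersurface, only the sign of a local defining function is retained. -/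
structure IsCrossSection {X : Type*} [TopologicalSpace X] (Φ : Flow ℝ X) (S : Set X) : Prop where
  isClosed : IsClosed S
  crossing : ∀ x ∈ S, ∃ U, IsOpen U ∧ x ∈ U ∧ ∃ g : X → ℝ, ContinuousOn g U ∧
    (∀ y ∈ U, y ∈ S ↔ g y = 0) ∧ ∀ᶠ s in 𝓝[>] 0, 0 < g (Φ s x) ∧ g (Φ (-s) x) < 0
  separated : ∀ x ∈ S, ∃ δ > 0, ∀ᶠ y in 𝓝[S] x, ∀ t ≠ 0, |t| ≤ δ → Φ t y ∉ S
  hits_pos : ∀ x, ∃ t > 0, Φ t x ∈ S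
  hits_neg : ∀ x, ∃ t < 0, Φ t x ∈ S

theorem IsGlobalPoincareSection.isCrossSection {X : Type*} [TopologicalSpace X] {n : ℕ}
    {Φ : Flow ℝ X} {S : Set X} (hS : IsGlobalPoincareSection n Φ S) : IsCrossSection Φ S where
  isClosed := hS.transversal.hypersurface.isClosed
  crossing x hx := by
    obtain ⟨-, δp, δm, h⟩ := isTopologicallyTransversal_iff.1 hS.transversal
    obtain ⟨hp, hm, ⟨U, hU, hflat, a, ha, b, hb, hab, hca, hcb⟩, -⟩ := h x hx
    obtain ⟨g, hgc, hgS, hga, hgb⟩ := hflat.exists_separating_function ha hb hab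
    refine ⟨interior U, isOpen_interior, mem_interior_iff_mem_nhds.2 hU, g,
      hgc.mono interior_subset, fun y hy => hgS y (interior_subset hy), ?_⟩
    filter_upwards [Ioc_mem_nhdsGT hp, Ioc_mem_nhdsGT (neg_pos.2 hm)] with s hsp hsm
    exact ⟨hgb _ (hcb s hsp), hga _ (hca (-s) ⟨le_neg.1 hsm.2, neg_neg_iff_pos.2 hsm.1⟩)⟩
  separated x hx := by
    obtain ⟨-, δp, δm, h⟩ := isTopologicallyTransversal_iff.1 hS.transversal
    obtain ⟨-, -, -, δ, hδ, hbound⟩ := h x hx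
    refine ⟨δ, hδ, ?_⟩
    filter_upwards [hbound, self_mem_nhdsWithin] with y ⟨hyp, hym⟩ hyS t ht htδ htS
    obtain ⟨-, -, hcross, -⟩ := h y hyS
    obtain ⟨hle, hge⟩ := abs_le.1 htδ
    exact ht (hcross.eq_zero_of_flow_mem ⟨hym.le.trans hle, hge.trans hyp.le⟩ htS)
  hits_pos x := (hS.hits x).1
  hits_neg x := (hS.hits x).2

section LocalCrossings

variable {X : Type*} [TopologicalSpace X]

theorem eventually_eventually_flow_mem (Φ : Flow ℝ X) {x : X} {U : Set X} (hU : U ∈ 𝓝 x) :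
    ∀ᶠ s in 𝓝[>] 0, ∀ᶠ z in 𝓝 x, ∀ t ∈ Icc (-s) s, Φ t z ∈ U := by
  have hcont : Continuous fun q : ℝ × X => Φ q.1 q.2 := by fun_prop
  have hmem : ∀ᶠ q in 𝓝 (0 : ℝ) ×ˢ 𝓝 x, Φ q.1 q.2 ∈ U := by
    rw [← nhds_prod_eq]
    exact hcont.continuousAt.eventually_mem (by simpa using hU)
  obtain ⟨p, hp, q, hq, hpq⟩ := eventually_prod_iff.1 hmem
  obtain ⟨ε, hε, hball⟩ := Metric.eventually_nhds_iff.1 hp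
  filter_upwards [Ioo_mem_nhdsGT hε] with s hs
  filter_upwards [hq] with z hz t ht
  exact hpq (hball (by simpa using (abs_le.2 ht).trans_lt hs.2)) hz

theorem eventually_exists_flow_eq_zero (Φ : Flow ℝ X) {x : X} {U : Set X} (hU : IsOpen U)
    {g : X → ℝ} (hg : ContinuousOn g U) {s : ℝ} (hs : 0 ≤ s)
    (hmem : ∀ᶠ z in 𝓝 x, ∀ t ∈ Icc (-s) s, Φ t z ∈ U) (hpos : 0 < g (Φ s x))
    (hneg : g (Φ (-s) x) < 0) :
    ∀ᶠ z in 𝓝 x, ∃ t ∈ Icc (-s) s, Φ t z ∈ U ∧ g (Φ t z) = 0 := by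
  have hcont {t : ℝ} (ht : t ∈ Icc (-s) s) : ContinuousAt (fun z => g (Φ t z)) x :=
    (hg.continuousAt (hU.mem_nhds (hmem.self_of_nhds t ht))).comp (f := Φ t)
      (Φ.continuous_toFun t).continuousAt
  have hle : -s ≤ s := by linarith
  filter_upwards [hmem, (hcont (right_mem_Icc.2 hle)).eventually_const_lt hpos,
    (hcont (left_mem_Icc.2 hle)).eventually_lt_const hneg] with z hz hzp hzm
  obtain ⟨t, ht, ht0⟩ := intermediate_value_Icc hle
    (hg.comp (f := fun t => Φ t z) (by fun_prop) hz) ⟨hzm.le, hzp.le⟩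
  exact ⟨t, ht, hz t ht, ht0⟩

end LocalCrossings

/-- The first positive time at which the orbit of `x` is in `S`; the junk value is `0`. -/
noncomputable def returnTime {X : Type*} [TopologicalSpace X] (Φ : Flow ℝ X) (S : Set X)
    (x : X) : ℝ :=
  sInf {t | 0 < t ∧ Φ t x ∈ S}

namespace IsCrossSection

variable {X : Type*} [TopologicalSpace X] {Φ : Flow ℝ X} {S : Set X}

theorem reverse (h : IsCrossSection Φ S) : IsCrossSection Φ.reverse S where
  isClosed := h.isClosed
  crossing x hx := by
    obtain ⟨U, hU, hxU, g, hgc, hgS, hside⟩ := h.crossing x hx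
    refine ⟨U, hU, hxU, fun y => -g y, hgc.neg, fun y hy => by simp [hgS y hy], ?_⟩
    filter_upwards [hside] with s ⟨hp, hm⟩
    exact ⟨neg_pos.2 hm, by simpa using hp⟩
  separated x hx := by
    obtain ⟨δ, hδ, hsep⟩ := h.separated x hx
    exact ⟨δ, hδ, hsep.mono fun y hy t ht htδ => hy (-t) (neg_ne_zero.2 ht) (by rwa [abs_neg])⟩
  hits_pos x := by
    obtain ⟨t, ht, hS⟩ := h.hits_neg x
    exact ⟨-t, neg_pos.2 ht, by simpa using hS⟩
  hits_neg x := by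
    obtain ⟨t, ht, hS⟩ := h.hits_pos x
    exact ⟨-t, neg_neg_iff_pos.2 ht, by simpa using hS⟩

theorem eventually_exists_hit (h : IsCrossSection Φ S) {x : X} {r : ℝ} (hx : Φ r x ∈ S) {ε : ℝ}
    (hε : 0 < ε) : ∀ᶠ z in 𝓝 x, ∃ t ∈ Ioo (r - ε) (r + ε), Φ t z ∈ S := by
  obtain ⟨U, hU, hxU, g, hgc, hgS, hside⟩ := h.crossing _ hx
  obtain ⟨s, ⟨⟨hp, hm⟩, hmem⟩, hs0, hsε⟩ := ((hside.and
    (eventually_eventually_flow_mem Φ (hU.mem_nhds hxU))).and (Ioo_mem_nhdsGT hε)).exists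
  filter_upwards [(Φ.continuous_toFun r).continuousAt.eventually
    (eventually_exists_flow_eq_zero Φ hU hgc hs0.le hmem hp hm)] with z ⟨t, ht, htU, ht0⟩
  refine ⟨t + r, ⟨by linarith [ht.1], by linarith [ht.2]⟩, ?_⟩
  rw [Φ.map_add]
  exact (hgS _ htU).2 ht0

theorem isDiscrete_hits (h : IsCrossSection Φ S) (x : X) : IsDiscrete {t | Φ t x ∈ S} := by
  refine .of_nhdsWithin fun r hr => ?_
  obtain ⟨δ, hδ, hsep⟩ := h.separated _ hr
  rw [le_pure_iff]
  filter_upwards [nhdsWithin_le_nhds (Metric.closedBall_mem_nhds r hδ), self_mem_nhdsWithin]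
    with t htr (htS : Φ t x ∈ S)
  by_contra hne
  refine hsep.self_of_nhdsWithin hr (t - r) (sub_ne_zero.2 hne) htr ?_
  rwa [← Φ.map_add, sub_add_cancel]

theorem finite_hits (h : IsCrossSection Φ S) (x : X) (a b : ℝ) :
    (Icc a b ∩ {t | Φ t x ∈ S}).Finite :=
  Metric.finite_isBounded_inter_isClosed (h.isDiscrete_hits x) (Metric.isBounded_Icc a b)
    (h.isClosed.preimage (by fun_prop))

theorem isLeast_returnTime (h : IsCrossSection Φ S) (x : X) :
    IsLeast {t | 0 < t ∧ Φ t x ∈ S} (returnTime Φ S x) := by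
  obtain ⟨b, hb, hbS⟩ := h.hits_pos x
  have hfinite : (Ioc 0 b ∩ {t | Φ t x ∈ S}).Finite :=
    (h.finite_hits x 0 b).subset (inter_subset_inter_left _ Ioc_subset_Icc_self)
  obtain ⟨t, ⟨⟨ht, htb⟩, htS⟩, hmin⟩ := hfinite.isCompact.exists_isLeast ⟨b, ⟨hb, le_rfl⟩, hbS⟩
  have hleast : IsLeast {t | 0 < t ∧ Φ t x ∈ S} t :=
    ⟨⟨ht, htS⟩, fun s hs => (le_total s b).elim (fun hsb => hmin ⟨⟨hs.1, hsb⟩, hs.2⟩) htb.trans⟩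
  rwa [returnTime, hleast.csInf_eq]

theorem returnTime_pos (h : IsCrossSection Φ S) (x : X) : 0 < returnTime Φ S x :=
  (h.isLeast_returnTime x).1.1

theorem flow_returnTime_mem (h : IsCrossSection Φ S) (x : X) : Φ (returnTime Φ S x) x ∈ S :=
  (h.isLeast_returnTime x).1.2

theorem returnTime_le (h : IsCrossSection Φ S) {x : X} {t : ℝ} (ht : 0 < t) (htS : Φ t x ∈ S) :
    returnTime Φ S x ≤ t :=
  (h.isLeast_returnTime x).2 ⟨ht, htS⟩

theorem eventually_returnTime_lt (h : IsCrossSection Φ S) {x : X} {a : ℝ}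
    (ha : returnTime Φ S x < a) : ∀ᶠ y in 𝓝 x, returnTime Φ S y < a := by
  have hε : 0 < min (returnTime Φ S x) (a - returnTime Φ S x) :=
    lt_min (h.returnTime_pos x) (sub_pos.2 ha)
  filter_upwards [h.eventually_exists_hit (h.flow_returnTime_mem x) hε] with y ⟨t, ht, htS⟩
  have hpos : 0 < t := by linarith [ht.1, min_le_left (returnTime Φ S x) (a - returnTime Φ S x)]
  linarith [h.returnTime_le hpos htS, ht.2,
    min_le_right (returnTime Φ S x) (a - returnTime Φ S x)]

theorem eventually_lt_returnTime (h : IsCrossSection Φ S) {x : X} (hx : x ∈ S) {a : ℝ}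
    (ha : a < returnTime Φ S x) : ∀ᶠ y in 𝓝[S] x, a < returnTime Φ S y := by
  obtain ⟨δ, hδ, hsep⟩ := h.separated x hx
  have hmiss : ∀ᶠ y in 𝓝 x, ∀ t ∈ Icc δ a, Φ t y ∉ S := by
    refine isCompact_Icc.eventually_forall_of_forall_eventually fun t ht => ?_
    have hcont : Continuous fun q : X × ℝ => Φ q.2 q.1 := by fun_prop
    refine hcont.continuousAt.eventually (h.isClosed.isOpen_compl.mem_nhds fun htS => ?_)
    exact (h.returnTime_le (hδ.trans_le ht.1) htS).not_gt (ht.2.trans_lt ha)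
  filter_upwards [hsep, nhdsWithin_le_nhds hmiss] with y hy hyK
  have hpos := h.returnTime_pos y
  have hmem := h.flow_returnTime_mem y
  by_contra! hle
  rcases le_total δ (returnTime Φ S y) with hδy | hδy
  · exact hyK _ ⟨hδy, hle⟩ hmem
  · exact hy _ hpos.ne' (by rwa [abs_of_pos hpos]) hmem

theorem continuous_returnTime (h : IsCrossSection Φ S) :
    Continuous fun x : S => returnTime Φ S x := by
  have hon : ContinuousOn (returnTime Φ S) S := fun x hx => tendsto_order.2
    ⟨fun a ha => h.eventually_lt_returnTime hx ha,
      fun a ha => nhdsWithin_le_nhds (h.eventually_returnTime_lt ha)⟩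
  exact continuousOn_iff_continuous_domRestrict.1 hon

theorem returnTime_reverse (h : IsCrossSection Φ S) {x : X} (hx : x ∈ S) :
    returnTime Φ.reverse S (Φ (returnTime Φ S x) x) = returnTime Φ S x := by
  refine (h.reverse.isLeast_returnTime _).unique
    ⟨⟨h.returnTime_pos x, by simpa [← Φ.map_add] using hx⟩, fun t ⟨ht, htS⟩ => ?_⟩
  by_contra! hlt
  rw [Flow.reverse_apply, ← Φ.map_add] at htS
  linarith [h.returnTime_le (by linarith) htS]

theorem returnTime_of_reverse (h : IsCrossSection Φ S) {x : X} (hx : x ∈ S) :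
    returnTime Φ S (Φ (-returnTime Φ.reverse S x) x) = returnTime Φ.reverse S x := by
  have hrr : Φ.reverse.reverse = Φ := Flow.ext fun t x => by simp
  simpa [hrr] using h.reverse.returnTime_reverse hx

/-- The Poincaré map of a cross-section. -/
noncomputable def poincareHomeomorph (h : IsCrossSection Φ S) : S ≃ₜ S where
  toFun x := ⟨Φ (returnTime Φ S x) x, h.flow_returnTime_mem x⟩
  invFun x := ⟨Φ (-returnTime Φ.reverse S x) x, h.reverse.flow_returnTime_mem x⟩
  left_inv x := Subtype.ext <| by simp [h.returnTime_reverse x.2, ← Φ.map_add]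
  right_inv x := Subtype.ext <| by simp [h.returnTime_of_reverse x.2, ← Φ.map_add]
  continuous_toFun := (Φ.continuous h.continuous_returnTime continuous_subtype_val).subtype_mk _
  continuous_invFun :=
    (Φ.continuous h.reverse.continuous_returnTime.neg continuous_subtype_val).subtype_mk _

theorem coe_poincareHomeomorph (h : IsCrossSection Φ S) (x : S) :
    (h.poincareHomeomorph x : X) = Φ (returnTime Φ S x) x :=
  rfl

theorem isPoincareMap (h : IsCrossSection Φ S) : IsPoincareMap Φ S h.poincareHomeomorph :=
  fun x => ⟨returnTime Φ S x, h.isLeast_returnTime x, rfl⟩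

/-- The time at which the orbit of `x` meets the cross-section for the `n`-th time. -/
noncomputable def hitTime (h : IsCrossSection Φ S) (n : ℤ) (x : S) : ℝ :=
  intBirkhoffSum h.poincareHomeomorph (fun y => returnTime Φ S y) n x

theorem flow_hitTime (h : IsCrossSection Φ S) (n : ℤ) (x : S) :
    Φ (h.hitTime n x) x = (h.poincareHomeomorph ^ n) x := by
  have step (n : ℤ) : Φ (h.hitTime (n + 1) x) x = (h.poincareHomeomorph ^ (n + 1)) x ↔
      Φ (h.hitTime n x) x = (h.poincareHomeomorph ^ n) x := by
    rw [hitTime, intBirkhoffSum_add_one, add_comm, Φ.map_add, ← apply_zpow_apply,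
      coe_poincareHomeomorph]
    exact (Φ.toHomeomorph _).injective.eq_iff
  induction n with
  | zero => simp [hitTime, intBirkhoffSum_zero]
  | succ n ih => exact (step _).2 ih
  | pred n ih => exact (step _).1 (by simpa using ih)

theorem strictMono_hitTime (h : IsCrossSection Φ S) (x : S) :
    StrictMono fun n => h.hitTime n x :=
  strictMono_intBirkhoffSum (T := fun y : S => returnTime Φ S y) (fun y => h.returnTime_pos y) x

theorem exists_hitTime_notMem_Icc (h : IsCrossSection Φ S) (x : S) {A : Set ℤ}
    (hA : A.Infinite) (a b : ℝ) : ∃ n ∈ A, h.hitTime n x ∉ Icc a b := by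
  by_contra! hmem
  have hfinite := (h.finite_hits x a b).preimage (h.strictMono_hitTime x).injective.injOn
  refine hA (hfinite.subset fun n hn => ⟨hmem n hn, ?_⟩)
  rw [mem_ofPred_eq, flow_hitTime]
  exact Subtype.prop _

theorem surjective_roofTime_returnTime (h : IsCrossSection Φ S) (x : S) :
    Function.Surjective (roofTime h.poincareHomeomorph (fun y => returnTime Φ S y) x) := by
  have hmono := (h.strictMono_hitTime x).monotone
  have hzero : h.hitTime 0 x = 0 := intBirkhoffSum_zero x
  refine surjective_roofTime (T := fun y : S => returnTime Φ S y) (fun y => h.returnTime_pos y)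
    (fun r => ?_) fun r => ?_
  · obtain ⟨n, hn, hnr⟩ := h.exists_hitTime_notMem_Icc x (Iic_infinite 0) r 0
    exact ⟨n, (not_le.1 fun hr => hnr ⟨hr, (hmono hn).trans_eq hzero⟩).le⟩
  · obtain ⟨n, hn, hnr⟩ := h.exists_hitTime_notMem_Icc x (Ici_infinite 0) 0 r
    exact ⟨n, not_le.1 fun hr => hnr ⟨hzero.ge.trans (hmono hn), hr⟩⟩

/-- The map sending `(x, t)` to the point of the orbit of `x` at the fraction `t` of its way back
to the section. -/
noncomputable def sweep (Φ : Flow ℝ X) (S : Set X) (p : S × unitInterval) : X :=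
  Φ (p.2 * returnTime Φ S p.1) p.1

theorem continuous_sweep (h : IsCrossSection Φ S) : Continuous (sweep Φ S) :=
  Φ.continuous ((continuous_subtype_val.comp continuous_snd).mul
    (h.continuous_returnTime.comp continuous_fst)) (continuous_subtype_val.comp continuous_fst)

theorem mul_returnTime_le_of_flow_sweep_mem (h : IsCrossSection Φ S) {p : S × unitInterval} {t : ℝ}
    (ht : t < 0) (htS : Φ t (sweep Φ S p) ∈ S) : p.2 * returnTime Φ S p.1 ≤ -t := by
  have hle : p.2 * returnTime Φ S p.1 ≤ returnTime Φ S p.1 :=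
    mul_le_of_le_one_left (h.returnTime_pos p.1).le p.2.2.2
  by_contra! hlt
  rw [sweep, ← Φ.map_add] at htS
  linarith [h.returnTime_le (by linarith) htS]

theorem exists_tendsto_of_tendsto_sweep (h : IsCrossSection Φ S) {ι : Type*} {F : Filter ι}
    [F.NeBot] {p : ι → S × unitInterval} {r : ℝ} {y : X}
    (hr : Tendsto (fun i => (p i).2 * returnTime Φ S (p i).1) F (𝓝 r))
    (hy : Tendsto (fun i => sweep Φ S (p i)) F (𝓝 y)) :
    ∃ q, sweep Φ S q = y ∧ Tendsto p F (𝓝 q) := by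
  have hcont : Continuous fun q : ℝ × X => Φ (-q.1) q.2 := by fun_prop
  have hbase : Tendsto (fun i => ((p i).1 : X)) F (𝓝 (Φ (-r) y)) :=
    ((hcont.tendsto (r, y)).comp (hr.prodMk_nhds hy)).congr fun i => by simp [sweep, ← Φ.map_add]
  have hmem : Φ (-r) y ∈ S := h.isClosed.mem_of_tendsto hbase (.of_forall fun i => (p i).1.2)
  have hfst : Tendsto (fun i => (p i).1) F (𝓝 ⟨Φ (-r) y, hmem⟩) := tendsto_subtype_rng.2 hbase
  have hT : returnTime Φ S (Φ (-r) y) ≠ 0 := (h.returnTime_pos _).ne'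
  have hsnd : Tendsto (fun i => ((p i).2 : ℝ)) F (𝓝 (r / returnTime Φ S (Φ (-r) y))) :=
    (hr.div ((h.continuous_returnTime.tendsto _).comp hfst) hT).congr fun i =>
      mul_div_cancel_right₀ _ (h.returnTime_pos _).ne'
  have hunit : r / returnTime Φ S (Φ (-r) y) ∈ unitInterval :=
    isClosed_Icc.mem_of_tendsto hsnd (.of_forall fun i => (p i).2.2)
  refine ⟨(⟨Φ (-r) y, hmem⟩, ⟨_, hunit⟩), ?_, hfst.prodMk_nhds (tendsto_subtype_rng.2 hsnd)⟩
  simp [sweep, div_mul_cancel₀ _ hT, ← Φ.map_add]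

theorem isProperMap_sweep (h : IsCrossSection Φ S) : IsProperMap (sweep Φ S) := by
  refine isProperMap_iff_ultrafilter.2 ⟨h.continuous_sweep, fun 𝒰 y hy => ?_⟩
  obtain ⟨t₀, ht₀, ht₀S⟩ := h.hits_neg y
  have hbounded : ∀ᶠ p in (𝒰 : Filter (S × unitInterval)),
      p.2 * returnTime Φ S p.1 ∈ Icc 0 (-(2 * t₀)) := by
    filter_upwards [hy.eventually (h.eventually_exists_hit ht₀S (neg_pos.2 ht₀))]
      with p ⟨t, ht, htS⟩
    have hle := h.mul_returnTime_le_of_flow_sweep_mem (by linarith [ht.2]) htS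
    exact ⟨mul_nonneg p.2.2.1 (h.returnTime_pos _).le, by linarith [ht.1]⟩
  obtain ⟨r, -, hr⟩ := isCompact_Icc.ultrafilter_le_nhds
    (𝒰.map fun p : S × unitInterval => (p.2 : ℝ) * returnTime Φ S p.1) (le_principal_iff.2 hbounded)
  exact h.exists_tendsto_of_tendsto_sweep (p := id) hr hy

end IsCrossSection

namespace MappingTorus

variable {X : Type*} [TopologicalSpace X] {f : X ≃ₜ X} {T : X → ℝ}

theorem exists_lt_one_mk_eq (z : MappingTorus f) :
    ∃ p : X × unitInterval, p.2 < 1 ∧ mk f p = z := by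
  obtain ⟨p, rfl⟩ := (isQuotientMap_mk f).surjective z
  rcases p.2.2.2.lt_or_eq with hp | hp
  · exact ⟨p, hp, rfl⟩
  · refine ⟨(f p.1, 0), zero_lt_one, ?_⟩
    rw [← mk_one, show (1 : unitInterval) = p.2 from Subtype.ext hp.symm]

/-- The time that the special flow over `f` with roof function `T`, started at `z`, needs for what
the suspension flow of `f` does in time `s`. -/
noncomputable def timeChange (f : X ≃ₜ X) (T : X → ℝ) : MappingTorus f → ℝ → ℝ :=
  Quot.lift (fun p s => roofTime f T p.1 (s + p.2) - roofTime f T p.1 p.2) <| by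
    rintro ⟨x, t⟩ q ⟨ht, rfl⟩
    obtain rfl : t = 1 := ht
    funext s
    have hone := roofTime_add_one (f := f) (T := T) x 0
    rw [zero_add] at hone
    simp [roofTime_add_one, hone]

theorem timeChange_mk (p : X × unitInterval) (s : ℝ) :
    timeChange f T (mk f p) s = roofTime f T p.1 (s + p.2) - roofTime f T p.1 p.2 :=
  rfl

theorem timeChange_mk_zero (x : X) : timeChange f T (mk f (x, 0)) = roofTime f T x := by
  funext s
  simp [timeChange_mk, roofTime_zero]

theorem timeChange_zero (z : MappingTorus f) : timeChange f T z 0 = 0 := by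
  obtain ⟨p, rfl⟩ := (isQuotientMap_mk f).surjective z
  simp [timeChange_mk]

theorem strictMono_timeChange (hT : ∀ x, 0 < T x) (z : MappingTorus f) :
    StrictMono (timeChange f T z) := by
  obtain ⟨p, rfl⟩ := (isQuotientMap_mk f).surjective z
  exact fun s t hst => sub_lt_sub_right (strictMono_roofTime hT _ (by simpa using hst)) _

theorem surjective_timeChange (hT : ∀ x, Function.Surjective (roofTime f T x))
    (z : MappingTorus f) : Function.Surjective (timeChange f T z) := by
  obtain ⟨p, rfl⟩ := (isQuotientMap_mk f).surjective z
  intro r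
  obtain ⟨u, hu⟩ := hT p.1 (r + roofTime f T p.1 p.2)
  exact ⟨u - p.2, by simp [timeChange_mk, hu]⟩

end MappingTorus

namespace IsCrossSection

variable {X : Type*} [TopologicalSpace X] {Φ : Flow ℝ X} {S : Set X}

/-- The map from the mapping torus of the Poincaré map to the phase space induced by `sweep`. -/
noncomputable def torusMap (h : IsCrossSection Φ S) : MappingTorus h.poincareHomeomorph → X :=
  Quot.lift (sweep Φ S) <| by
    rintro ⟨x, t⟩ q ⟨ht, rfl⟩
    obtain rfl : t = 1 := ht
    simp [sweep, h.coe_poincareHomeomorph]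

theorem torusMap_mk (h : IsCrossSection Φ S) (p : S × unitInterval) :
    h.torusMap (MappingTorus.mk _ p) = Φ (p.2 * returnTime Φ S p.1) p.1 :=
  rfl

theorem torusMap_mk_zero (h : IsCrossSection Φ S) (x : S) :
    h.torusMap (MappingTorus.mk _ (x, 0)) = x := by
  simp [torusMap_mk]

theorem torusMap_unroll (h : IsCrossSection Φ S) (x : S) (u : ℝ) :
    h.torusMap (MappingTorus.unroll _ u x) =
      Φ (roofTime h.poincareHomeomorph (fun y => returnTime Φ S y) x u) x := by
  rw [MappingTorus.unroll, torusMap_mk, roofTime, add_comm, Φ.map_add]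
  exact congrArg _ (h.flow_hitTime _ _).symm

theorem eq_of_flow_eq_flow (h : IsCrossSection Φ S) {x y : S} {s t : ℝ}
    (hs : s ∈ Ico 0 (returnTime Φ S x)) (ht : t ∈ Ico 0 (returnTime Φ S y))
    (heq : Φ s x = Φ t y) : x = y ∧ s = t := by
  wlog hst : s ≤ t generalizing x y s t
  · exact (this ht hs heq.symm (le_of_not_ge hst)).imp Eq.symm Eq.symm
  have hx : (x : X) = Φ (t - s) y := by
    rw [sub_eq_neg_add, Φ.map_add, ← heq, ← Φ.map_add, neg_add_cancel, Φ.map_zero_apply]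
  obtain rfl : s = t := by
    by_contra hne
    have := h.returnTime_le (sub_pos.2 (lt_of_le_of_ne hst hne)) (hx ▸ x.2)
    linarith [hs.1, ht.2]
  exact ⟨Subtype.ext (by simpa using hx), rfl⟩

theorem injective_torusMap (h : IsCrossSection Φ S) : Function.Injective h.torusMap := by
  have hmem {x : S} {t : unitInterval} (ht : t < 1) :
      t * returnTime Φ S x ∈ Ico 0 (returnTime Φ S x) :=
    ⟨mul_nonneg t.2.1 (h.returnTime_pos x).le, mul_lt_of_lt_one_left (h.returnTime_pos x) ht⟩
  intro z w hzw
  obtain ⟨⟨x, s⟩, hs, rfl⟩ := z.exists_lt_one_mk_eq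
  obtain ⟨⟨y, t⟩, ht, rfl⟩ := w.exists_lt_one_mk_eq
  obtain ⟨rfl, hst⟩ := h.eq_of_flow_eq_flow (hmem hs) (hmem ht) hzw
  obtain rfl : s = t := Subtype.ext (mul_right_cancel₀ (h.returnTime_pos x).ne' hst)
  rfl

theorem surjective_torusMap (h : IsCrossSection Φ S) : Function.Surjective h.torusMap := by
  intro y
  obtain ⟨t, -, htS⟩ := h.hits_neg y
  obtain ⟨u, hu⟩ := h.surjective_roofTime_returnTime ⟨Φ t y, htS⟩ (-t)
  refine ⟨MappingTorus.unroll _ u ⟨Φ t y, htS⟩, ?_⟩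
  rw [torusMap_unroll, hu, ← Φ.map_add, neg_add_cancel, Φ.map_zero_apply]

theorem continuous_torusMap (h : IsCrossSection Φ S) : Continuous h.torusMap :=
  continuous_quot_lift _ h.continuous_sweep

theorem isHomeomorph_torusMap (h : IsCrossSection Φ S) : IsHomeomorph h.torusMap := by
  have hmk := MappingTorus.isQuotientMap_mk h.poincareHomeomorph
  have hproper : IsProperMap h.torusMap :=
    isProperMap_of_comp_of_surj hmk.continuous h.continuous_torusMap h.isProperMap_sweep
      hmk.surjective
  exact isHomeomorph_iff_continuous_isClosedMap_bijective.2
    ⟨h.continuous_torusMap, hproper.isClosedMap, h.injective_torusMap, h.surjective_torusMap⟩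

theorem torusMap_preimage (h : IsCrossSection Φ S) :
    h.torusMap ⁻¹' S = MappingTorus.zeroSection h.poincareHomeomorph := by
  refine Subset.antisymm (fun z hz => ⟨⟨h.torusMap z, hz⟩, ?_⟩) ?_
  · exact h.injective_torusMap (h.torusMap_mk_zero _)
  · rintro _ ⟨x, rfl⟩
    rw [mem_preimage, torusMap_mk_zero]
    exact x.2

/-- The map from the mapping torus to the phase space, as a weak morphism. -/
noncomputable def weakMorphism (h : IsCrossSection Φ S) :
    WeakMorphism (suspensionFlow h.poincareHomeomorph) Φ where
  toFun := h.torusMap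
  time := MappingTorus.timeChange h.poincareHomeomorph fun y => returnTime Φ S y
  continuous_toFun := h.continuous_torusMap
  map_flow z s := by
    obtain ⟨p, rfl⟩ := (MappingTorus.isQuotientMap_mk _).surjective z
    have hflow : suspensionFlow h.poincareHomeomorph s (MappingTorus.mk _ p) =
      MappingTorus.unroll _ (s + p.2) p.1 := rfl
    rw [hflow, torusMap_unroll, MappingTorus.timeChange_mk, torusMap_mk,
      ← roofTime_coe (f := h.poincareHomeomorph) (T := fun y : S => returnTime Φ S y),
      ← Φ.map_add, sub_add_cancel]
  time_isHomeomorph z := isHomeomorph_of_strictMono_of_surjective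
    (MappingTorus.strictMono_timeChange (T := fun y : S => returnTime Φ S y)
      (fun y => h.returnTime_pos y) z)
    (MappingTorus.surjective_timeChange h.surjective_roofTime_returnTime z)
  time_strictMono := MappingTorus.strictMono_timeChange (T := fun y : S => returnTime Φ S y)
    fun y => h.returnTime_pos y
  time_zero := MappingTorus.timeChange_zero

theorem continuousOn_weakMorphism_time (h : IsCrossSection Φ S) (s : ℝ) :
    ContinuousOn (fun z => h.weakMorphism.time z s) (h.torusMap ⁻¹' S) := by
  have hbase : Continuous fun z : h.torusMap ⁻¹' S => (⟨h.torusMap z, z.2⟩ : S) :=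
    (h.continuous_torusMap.comp continuous_subtype_val).subtype_mk _
  refine continuousOn_iff_continuous_domRestrict.2
    (((continuous_roofTime (f := h.poincareHomeomorph) h.continuous_returnTime s).comp hbase).congr
      fun ⟨z, hz⟩ => ?_)
  have hz' := hz
  rw [torusMap_preimage] at hz'
  obtain ⟨x, rfl⟩ := hz'
  have hx : (⟨h.torusMap (MappingTorus.mk _ (x, 0)), hz⟩ : S) = x :=
    Subtype.ext (h.torusMap_mk_zero x)
  exact (congrArg (roofTime _ _ · s) hx).trans
    (congrFun (MappingTorus.timeChange_mk_zero x) s).symm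

end IsCrossSection

theorem mainTheorem4_general {X : Type*} [TopologicalSpace X] (n : ℕ) (Φ : Flow ℝ X) (S : Set X)
    (hS : IsGlobalPoincareSection n Φ S) :
    ∃ f : S ≃ₜ S, IsPoincareMap Φ S f ∧
      IsGlobalPoincareSection n (suspensionFlow f) (MappingTorus.zeroSection f) ∧
      TopologicallyEquivalent Φ S (suspensionFlow f) (MappingTorus.zeroSection f) := by
  have h := hS.isCrossSection
  refine ⟨h.poincareHomeomorph, h.isPoincareMap, ?_⟩
  rw [← h.torusMap_preimage]
  exact ⟨hS.preimage h.weakMorphism h.isHomeomorph_torusMap h.continuousOn_weakMorphism_time,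
    h.weakMorphism.topologicallyEquivalent h.isHomeomorph_torusMap S⟩

theorem mainTheorem4 {X : Type*} [TopologicalSpace X] (n : ℕ) (hX : IsTopologicalManifold n X)
    (Φ : Flow ℝ X) (S : Set X) (hS : IsGlobalPoincareSection n Φ S) :
    ∃ f : S ≃ₜ S, IsPoincareMap Φ S f ∧
      IsTopologicalManifold n (MappingTorus f) ∧
      IsGlobalPoincareSection n (suspensionFlow f) (MappingTorus.zeroSection f) ∧
      TopologicallyEquivalent Φ S (suspensionFlow f) (MappingTorus.zeroSection f) := by
  obtain ⟨f, hf, hsection, hequiv⟩ := mainTheorem4_general n Φ S hS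
  exact ⟨f, hf, hX.of_homeomorph hequiv.nonempty_homeomorph.some, hsection, hequiv⟩
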